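/- Let $A$ be a finite alphabet and let $M$ be a finite monoid equipped with a map $\# : E(M)\to E(M)$, $e\mapsto e^\#$, on the set $E(M)$ of idempotents of $M$, such that for every $e\in E(M)$ one has $(e^\#)^\# = e^\#$ and $e e^\# = e^\# e = e^\#$. Let $\phi : A^*\to M$ be a monoid morphism. For $k>2$, a *$k$-decomposition tree* of a word $w\in A^*$ (with respect to $M$, $\#$, $\phi$) is a finite rooted ordered tree whose nodes are labeled by pairs $(u,U)\in A^*\times M$, whose root is labeled by $(w,W)$ for some $W\in M$, and each of whose nodes is of one of the following kinds: 1. a *leaf*: it has no children and is labeled by $(a,\phi(a))$ for some letter $a\in A$; 2. a *product node*: it has exactly two children, labeled (from left to right) by $(u,U)$ and $(v,V)$, and is itself labeled by $(uv,UV)$; 3. an *idempotent node*: it has $j$ children with $1\le j<k$, labeled by $(u_1,E),\dots,(u_j,E)$ for one idempotent $E\in E(M)$, and is itself labeled by $(u_1\cdots u_j,E)$; 4. an *iteration node*: it has $j\ge k$ children, labeled by $(u_1,E),\dots,(u_j,E)$ for one idempotent $E\in E(M)$, and is itself labeled by $(u_1\cdots u_j,E^\#)$. The height of a tree is the largest number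 of nodes on a path from the root to a leaf (so a single node has height $1$). **Theorem.** For every nonempty word $w\in A^*$ and every integer $k>3$ there exists a $k$-decomposition tree of $w$ with respect to $M$ whose height is at most $3\cdot|M|^2$. -/

import Mathlib

/-- The set `E(M)` of idempotent elements of a monoid `M`. -/
abbrev Idempotents (M : Type*) [Monoid M] : Type _ := {e : M // IsIdempotentElem e}

/-- Finite rooted ordered unranked trees whose nodes are labeled by pairs `(u, U)` of a word `u`
over the alphabet `A` and an element `U` of `M`: a node is given by its label, its number `j` of
children, and the sequence of its children from left to right. -/
inductive WordTree (A M : Type*) where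
  | node (u : FreeMonoid A) (U : M) (j : ℕ) (children : Fin j → WordTree A M) : WordTree A M

namespace WordTree

variable {A M : Type*}

/-- The left entry of the label of the root. -/
def word : WordTree A M → FreeMonoid A
  | node u _ _ _ => u

/-- The right entry of the label of the root, called the type of the node. -/
def type : WordTree A M → M
  | node _ U _ _ => U

/-- The height of a tree: the largest number of nodes on a path from the root to a leaf
(a tree consisting of a single node has height `1`). -/
def height : WordTree A M → ℕ
  | node _ _ _ children => (Finset.univ.sup fun i => (children i).height) + 1

/-- `T.IsDecomposition φ sharp k` says that `T` is a `k`-decomposition tree (of the word at its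
root), with respect to the monoid `M` with iteration operation `sharp : E(M) → E(M)` and the
morphism `φ`: every node is a leaf, a product node, an idempotent node or an iteration node. -/
inductive IsDecomposition [Monoid M] (φ : FreeMonoid A →* M)
    (sharp : Idempotents M → Idempotents M) (k : ℕ) : WordTree A M → Prop
  /-- Leaves: no children, labeled by `(a, φ(a))` for a letter `a`. -/
  | leaf (a : A) (c : Fin 0 → WordTree A M) :
      IsDecomposition φ sharp k (node (FreeMonoid.of a) (φ (FreeMonoid.of a)) 0 c)
  /-- Product nodes: two children labeled `(u, U)` and `(v, V)`; the label is `(uv, UV)`. -/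
  | product (c : Fin 2 → WordTree A M) (hc : ∀ i, IsDecomposition φ sharp k (c i)) :
      IsDecomposition φ sharp k
        (node ((c 0).word * (c 1).word) ((c 0).type * (c 1).type) 2 c)
  /-- Idempotent nodes: at least one and fewer than `k` children `(u₁, E), …, (uⱼ, E)` with `E`
  idempotent; the label is `(u₁ ⋯ uⱼ, E)`. -/
  | idempotent (E : Idempotents M) (j : ℕ) (hj : 1 ≤ j) (hjk : j < k)
      (c : Fin j → WordTree A M) (hc : ∀ i, IsDecomposition φ sharp k (c i))
      (hE : ∀ i, (c i).type = (E : M)) :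
      IsDecomposition φ sharp k
        (node (List.ofFn fun i => (c i).word).prod (E : M) j c)
  /-- Iteration nodes: at least `k` children `(u₁, E), …, (uⱼ, E)` with `E` idempotent; the label
  is `(u₁ ⋯ uⱼ, E^♯)`. -/
  | iteration (E : Idempotents M) (j : ℕ) (hkj : k ≤ j)
      (c : Fin j → WordTree A M) (hc : ∀ i, IsDecomposition φ sharp k (c i))
      (hE : ∀ i, (c i).type = (E : M)) :
      IsDecomposition φ sharp k
        (node (List.ofFn fun i => (c i).word).prod (sharp E : M) j c)

end WordTree

/-! As in Simon's factorization forest theorem, the tree is built by descending through the ideals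
of `M`. A nonempty ideal splits as `I = J ∪ K`, with `J` a maximal J-class and `K` a smaller ideal.
One level (`exists_trees_of_level`) turns a sequence of trees with types in `I` either into a single
tree or into a sequence with types in `K`.

Inside `J` (`IsStable.hasTree_or_hasDrop`), each inner position of a sequence carries the pair
(product to its left, product to its right). Fix a pair `c`. Between its first and last occurrence
the sequence is cut at all its occurrences; every piece fixes `c.1` on the right and `c.2` on the
left, and stability of `J` makes all pieces equal to one idempotent `E`. They are joined by one
node, and two products attach the ends. Each pair thus costs three levels, at most `3 * J.card ^ 2`
in all. If the joining node has type `sharp E ≠ E`, that type lies outside `J`, hence in `K`, which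
is progress as well.

Two more levels bring leftovers into `K`. They, and the height 1 of the leaves, are paid for by the
cross term of `3 * (J.card + K.card) ^ 2`; when `K` is empty, by a smaller set of possible pairs. -/

/-! ### Combining decomposition trees -/

section DecompositionTrees

variable {A M : Type*} [Monoid M]

/-- `HasTree φ sharp k n u U` says that `(u, U)` labels the root of a `k`-decomposition tree of
height at most `n`. -/
def HasTree (φ : FreeMonoid A →* M) (sharp : Idempotents M → Idempotents M) (k n : ℕ)
    (u : FreeMonoid A) (U : M) : Prop :=
  ∃ T : WordTree A M, T.IsDecomposition φ sharp k ∧ T.word = u ∧ T.type = U ∧ T.height ≤ n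

variable {φ : FreeMonoid A →* M} {sharp : Idempotents M → Idempotents M} {k : ℕ}

theorem HasTree.mono {m n : ℕ} (h : m ≤ n) {u : FreeMonoid A} {U : M}
    (H : HasTree φ sharp k m u U) : HasTree φ sharp k n u U := by
  obtain ⟨T, h1, h2, h3, h4⟩ := H
  exact ⟨T, h1, h2, h3, h4.trans h⟩

theorem HasTree.leaf (a : A) :
    HasTree φ sharp k 1 (FreeMonoid.of a) (φ (FreeMonoid.of a)) :=
  ⟨.node _ _ 0 Fin.elim0, .leaf a _, rfl, rfl, by simp [WordTree.height]⟩

theorem HasTree.mul {n : ℕ} {u v : FreeMonoid A} {U V : M} (hu : HasTree φ sharp k n u U)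
    (hv : HasTree φ sharp k n v V) : HasTree φ sharp k (n + 1) (u * v) (U * V) := by
  obtain ⟨S, s1, s2, s3, s4⟩ := hu
  obtain ⟨T, t1, t2, t3, t4⟩ := hv
  subst s2 s3 t2 t3
  refine ⟨_, .product ![S, T] (Fin.forall_fin_two.2 ⟨s1, t1⟩), rfl, rfl, ?_⟩
  simp only [WordTree.height]
  refine Nat.succ_le_succ (Finset.sup_le fun i _ => ?_)
  revert i
  exact Fin.forall_fin_two.2 ⟨fun _ => s4, fun _ => t4⟩

/-- Joining trees of the same idempotent type `E` gives a tree of type `E` or `sharp E`. -/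
theorem HasTree.prod {n : ℕ} {E : Idempotents M} {us : List (FreeMonoid A)} (hne : us ≠ [])
    (h : ∀ u ∈ us, HasTree φ sharp k n u E) :
    HasTree φ sharp k (n + 1) us.prod E ∨ HasTree φ sharp k (n + 1) us.prod (sharp E) := by
  have h' : ∀ i : Fin us.length, HasTree φ sharp k n (us.get i) E := fun i => h _ (us.get_mem i)
  choose T h1 h2 h3 h4 using h'
  have hw : (List.ofFn fun i => (T i).word) = us := by
    simp only [h2]
    exact List.ofFn_get us
  have hh : (Finset.univ.sup fun i => (T i).height) + 1 ≤ n + 1 :=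
    Nat.succ_le_succ (Finset.sup_le fun i _ => h4 i)
  by_cases hk : us.length < k
  · exact .inl ⟨_, .idempotent E _ (List.length_pos_of_ne_nil hne) hk T h1 h3,
      congrArg List.prod hw, rfl, hh⟩
  · exact .inr ⟨_, .iteration E _ (not_lt.1 hk) T h1 h3, congrArg List.prod hw, rfl, hh⟩

end DecompositionTrees

/-! ### Products of label sequences -/

section Labels

variable {A M : Type*}

/-- The product of the words of a sequence of labels. -/
def labelWord (L : List (FreeMonoid A × M)) : FreeMonoid A := (L.map Prod.fst).prod

@[simp] theorem labelWord_nil : labelWord ([] : List (FreeMonoid A × M)) = 1 := rfl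

@[simp] theorem labelWord_singleton (p : FreeMonoid A × M) : labelWord [p] = p.1 := by
  simp [labelWord]

@[simp] theorem labelWord_append (L R : List (FreeMonoid A × M)) :
    labelWord (L ++ R) = labelWord L * labelWord R := by
  simp [labelWord]

theorem labelWord_flatten (Ls : List (List (FreeMonoid A × M))) :
    labelWord Ls.flatten = (Ls.map labelWord).prod := by
  induction Ls with
  | nil => rfl
  | cons L Ls ih => simp [ih]

variable [Monoid M]

/-- The product of the types of a sequence of labels. -/
def labelType (L : List (FreeMonoid A × M)) : M := (L.map Prod.snd).prod

@[simp] theorem labelType_nil : labelType ([] : List (FreeMonoid A × M)) = 1 := rfl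

@[simp] theorem labelType_singleton (p : FreeMonoid A × M) : labelType [p] = p.2 := by
  simp [labelType]

@[simp] theorem labelType_append (L R : List (FreeMonoid A × M)) :
    labelType (L ++ R) = labelType L * labelType R := by
  simp [labelType]

end Labels

/-! ### Stable sets and maximal J-classes -/

section Stable

variable {M : Type*} [Monoid M]

/-- A set `J` in which products can be undone: if `u` and `x * u` lie in `J`, then `u` is a left
multiple of `x * u`, and symmetrically. -/
structure IsStable (J : Set M) : Prop where
  left : ∀ {x u : M}, u ∈ J → x * u ∈ J → ∃ z, z * (x * u) = u
  right : ∀ {u y : M}, u ∈ J → u * y ∈ J → ∃ z, u * y * z = u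

/-- Stability writes `u` as `z * a`, and `a` absorbs `u` from the right. -/
theorem IsStable.isIdempotentElem {J : Set M} (hJ : IsStable J) {a u : M} (ha : a ∈ J)
    (hu : u ∈ J) (hau : a * u = a) : IsIdempotentElem u := by
  obtain ⟨z, hz⟩ := hJ.left (x := a) hu (by rwa [hau])
  rw [hau] at hz
  rw [IsIdempotentElem]
  nth_rw 1 [← hz]
  rw [mul_assoc, hau, hz]

/-- There is at most one element of a stable set that fixes `a` from the right and `b` from the
left. -/
theorem IsStable.eq_of_fix {J : Set M} (hJ : IsStable J) {a b u v : M} (ha : a ∈ J) (hb : b ∈ J)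
    (hu : u ∈ J) (hv : v ∈ J) (hau : a * u = a) (hav : a * v = a) (hub : u * b = b)
    (hvb : v * b = b) : u = v := by
  obtain ⟨z, hz⟩ := hJ.left (x := a) hu (by rwa [hau])
  obtain ⟨y, hy⟩ := hJ.right (y := b) hv (by rwa [hvb])
  rw [hau] at hz
  rw [hvb] at hy
  -- Here `u = z * a` and `v = b * y`, so `u * v` equals both `u` and `v`.
  calc u = u * v := by rw [← hz, mul_assoc, hav]
    _ = v := by rw [← hy, ← mul_assoc, hub]

/-- If `sharp E` stayed in `J`, then `E = sharp E * z`, so multiplying by the idempotent `sharp E`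
on the left would fix `E`. -/
theorem IsStable.sharp_notMem {J : Set M} (hJ : IsStable J)
    {sharp : Idempotents M → Idempotents M}
    (mul_sharp : ∀ e : Idempotents M, (e : M) * (sharp e : M) = (sharp e : M))
    (sharp_mul : ∀ e : Idempotents M, (sharp e : M) * (e : M) = (sharp e : M))
    {E : Idempotents M} (hE : (E : M) ∈ J) (hne : sharp E ≠ E) : (sharp E : M) ∉ J := by
  intro h
  obtain ⟨z, hz⟩ := hJ.right (y := (sharp E : M)) hE (by rwa [mul_sharp])
  rw [mul_sharp] at hz
  refine hne (Subtype.ext ?_)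
  calc (sharp E : M) = sharp E * E := (sharp_mul E).symm
    _ = sharp E * (sharp E * z) := by rw [hz]
    _ = E := by rw [← mul_assoc, (sharp E).2.eq, hz]

/-- In a finite monoid, `u = c * u * t` forces `u` to be a left multiple of `c * u`. -/
theorem exists_mul_mul_eq_of_eq_mul_mul_left [Finite M] {c u t : M} (h : c * u * t = u) :
    ∃ z, z * (c * u) = u := by
  obtain ⟨i, j, hij, he⟩ : ∃ i j : ℕ, i < j ∧ c ^ i = c ^ j := by
    obtain ⟨i, j, hne, he⟩ := Finite.exists_ne_map_eq_of_infinite fun n : ℕ => c ^ n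
    rcases hne.lt_or_gt with h | h
    exacts [⟨i, j, h, he⟩, ⟨j, i, h, he.symm⟩]
  have hn : ∀ n : ℕ, c ^ n * u * t ^ n = u := by
    intro n
    induction n with
    | zero => simp
    | succ n ih =>
      rw [pow_succ, pow_succ', show c ^ n * c * u * (t * t ^ n) = c ^ n * (c * u * t) * t ^ n by
        simp only [mul_assoc], h, ih]
  obtain ⟨d, rfl⟩ := Nat.exists_eq_add_of_lt hij
  -- The powers of `c` repeat with period `d + 1`, so `c ^ (d + 1)` fixes `u = c ^ i * u * t ^ i`.
  refine ⟨c ^ d, ?_⟩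
  calc c ^ d * (c * u) = c ^ (d + 1) * (c ^ i * u * t ^ i) := by rw [hn, pow_succ, mul_assoc]
    _ = c ^ (i + d + 1) * u * t ^ i := by
      rw [show i + d + 1 = (d + 1) + i by omega, pow_add c (d + 1)]
      simp only [mul_assoc]
    _ = u := by rw [← he, hn]

theorem exists_mul_mul_eq_of_eq_mul_mul_right [Finite M] {c u t : M} (h : t * (u * c) = u) :
    ∃ z, u * c * z = u := by
  have : Finite Mᵐᵒᵖ := Finite.of_equiv M MulOpposite.opEquiv
  obtain ⟨z, hz⟩ := exists_mul_mul_eq_of_eq_mul_mul_left (M := Mᵐᵒᵖ) (c := .op c) (u := .op u)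
    (t := .op t) (MulOpposite.unop_injective (by simpa [mul_assoc] using h))
  exact ⟨z.unop, by simpa using congrArg MulOpposite.unop hz⟩

/-- A two-sided ideal, given as a finite set. -/
def IsMulIdeal (I : Finset M) : Prop := ∀ s t : M, ∀ m ∈ I, s * m * t ∈ I

/-- A nonempty ideal is the disjoint union of a smaller ideal and a nonempty stable set: a maximal
`J`-class. -/
theorem IsMulIdeal.exists_stable [Finite M] {I : Finset M} (hI : IsMulIdeal I)
    (hne : I.Nonempty) : ∃ J K : Finset M, J.Nonempty ∧ IsStable (J : Set M) ∧ IsMulIdeal K ∧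
      (∀ m, m ∈ I ↔ m ∈ J ∨ m ∈ K) ∧ Disjoint J K := by
  classical
  have := Fintype.ofFinite M
  let P : M → Finset M := fun m => Finset.univ.image fun q : M × M => q.1 * m * q.2
  have memP : ∀ {m x}, x ∈ P m ↔ ∃ s t, s * m * t = x := by simp [P]
  have selfP : ∀ m, m ∈ P m := fun m => memP.2 ⟨1, 1, by simp⟩
  have subP : ∀ s m t, P (s * m * t) ⊆ P m := by
    intro s m t x hx
    obtain ⟨a, b, rfl⟩ := memP.1 hx
    exact memP.2 ⟨a * s, t * b, by simp only [mul_assoc]⟩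
  obtain ⟨j, hj, hmax⟩ := I.exists_max_image (fun m => (P m).card) hne
  refine ⟨I.filter fun m => P m = P j, I.filter fun m => P m ≠ P j, ⟨j, by simp [hj]⟩,
    ⟨?_, ?_⟩, ?_, ?_, ?_⟩
  · intro x u hu hxu
    simp only [Finset.coe_filter, Set.mem_ofPred_eq] at hu hxu
    obtain ⟨s, t, h⟩ := memP.1 (hxu.2.trans hu.2.symm ▸ selfP u : u ∈ P (x * u))
    obtain ⟨z, hz⟩ := exists_mul_mul_eq_of_eq_mul_mul_left (c := s * x) (u := u) (t := t)
      (by simpa only [mul_assoc] using h)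
    exact ⟨z * s, by simpa only [mul_assoc] using hz⟩
  · intro u x hu hxu
    simp only [Finset.coe_filter, Set.mem_ofPred_eq] at hu hxu
    obtain ⟨s, t, h⟩ := memP.1 (hxu.2.trans hu.2.symm ▸ selfP u : u ∈ P (u * x))
    obtain ⟨z, hz⟩ := exists_mul_mul_eq_of_eq_mul_mul_right (c := x * t) (u := u) (t := s)
      (by simpa only [mul_assoc] using h)
    exact ⟨t * z, by simpa only [mul_assoc] using hz⟩
  · intro s t m hm
    simp only [Finset.mem_filter] at hm ⊢
    refine ⟨hI s t m hm.1, fun h => hm.2 ?_⟩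
    -- `P j` has maximal size, so this inclusion is an equality.
    have hsub : P j ⊆ P m := h ▸ subP s m t
    exact (Finset.eq_of_subset_of_card_le hsub (hmax m hm.1)).symm
  · intro m
    simp only [Finset.mem_filter]
    tauto
  · exact Finset.disjoint_filter_filter_not _ _ _

end Stable

/-! ### Sequences inside one stable set -/

section Smooth

variable {A M : Type*} [Monoid M]

/-- `CutsIn L x y S`: in the context `(x, y)`, the pairs formed by the products of what is to the
left and what is to the right of an inner position of `L` all lie in `S`. -/
def CutsIn (L : List (FreeMonoid A × M)) (x y : M) (S : Set (M × M)) : Prop :=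
  ∀ P Q, P ≠ [] → Q ≠ [] → L = P ++ Q → (x * labelType P, labelType Q * y) ∈ S

/-- The context absorbs the removed half, so every position keeps its pair and one set `S` serves
all pieces. -/
theorem CutsIn.left {P Q : List (FreeMonoid A × M)} {x y : M} {S : Set (M × M)}
    (h : CutsIn (P ++ Q) x y S) : CutsIn P x (labelType Q * y) S := by
  rintro P₁ P₂ h₁ h₂ rfl
  have := h P₁ (P₂ ++ Q) h₁ (by simp [h₂]) (by simp)
  simpa [mul_assoc] using this

theorem CutsIn.right {P Q : List (FreeMonoid A × M)} {x y : M} {S : Set (M × M)}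
    (h : CutsIn (P ++ Q) x y S) : CutsIn Q (x * labelType P) y S := by
  rintro Q₁ Q₂ h₁ h₂ rfl
  have := h (P ++ Q₁) Q₂ (by simp [h₁]) h₂ (by simp)
  simpa [mul_assoc] using this

/-- Either no inner position has the pair `c`, or there is a first one that has. -/
theorem exists_first_cut (c : M × M) (L : List (FreeMonoid A × M)) (x y : M) :
    CutsIn L x y {c}ᶜ ∨ ∃ P Q, P ≠ [] ∧ Q ≠ [] ∧ L = P ++ Q ∧ x * labelType P = c.1 ∧
      labelType Q * y = c.2 ∧ CutsIn P x c.2 {c}ᶜ := by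
  induction hn : L.length using Nat.strong_induction_on generalizing L y with
  | _ n ih =>
    by_cases h : CutsIn L x y {c}ᶜ
    · exact .inl h
    · right
      simp only [CutsIn, not_forall, Set.mem_compl_iff, Set.mem_singleton_iff, not_not] at h
      obtain ⟨P, Q, hP, hQ, rfl, rfl⟩ := h
      have hlt : P.length < n := by
        have := List.length_pos_of_ne_nil hQ
        simp only [List.length_append] at hn
        omega
      rcases ih _ hlt P (labelType Q * y) rfl with h | ⟨P₁, P₂, h₁, h₂, rfl, h₃, h₄, h₅⟩
      · exact ⟨P, Q, hP, hQ, rfl, rfl, rfl, h⟩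
      · exact ⟨P₁, P₂ ++ Q, h₁, by simp [h₂], by simp, h₃, by simpa [mul_assoc] using h₄, h₅⟩

/-- Either no inner position has the pair `c`, or there is a last one that has. -/
theorem exists_last_cut (c : M × M) (L : List (FreeMonoid A × M)) (x y : M) :
    CutsIn L x y {c}ᶜ ∨ ∃ P Q, P ≠ [] ∧ Q ≠ [] ∧ L = P ++ Q ∧ x * labelType P = c.1 ∧
      labelType Q * y = c.2 ∧ CutsIn Q c.1 y {c}ᶜ := by
  induction hn : L.length using Nat.strong_induction_on generalizing L x with
  | _ n ih =>
    by_cases h : CutsIn L x y {c}ᶜ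
    · exact .inl h
    · right
      simp only [CutsIn, not_forall, Set.mem_compl_iff, Set.mem_singleton_iff, not_not] at h
      obtain ⟨P, Q, hP, hQ, rfl, rfl⟩ := h
      have hlt : Q.length < n := by
        have := List.length_pos_of_ne_nil hP
        simp only [List.length_append] at hn
        omega
      rcases ih _ hlt Q (x * labelType P) rfl with h | ⟨Q₁, Q₂, h₁, h₂, rfl, h₃, h₄, h₅⟩
      · exact ⟨P, Q, hP, hQ, rfl, rfl, rfl, h⟩
      · exact ⟨P ++ Q₁, Q₂, by simp [h₁], h₂, by simp, by simpa [mul_assoc] using h₃, h₄, h₅⟩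

/-- A sequence that fixes both components of `c` can be cut at all inner positions with the pair
`c`; the pieces also fix both components. -/
theorem exists_flatten_cuts (c : M × M) (S : Set (M × M)) (L : List (FreeMonoid A × M))
    (hL : L ≠ []) (h₁ : c.1 * labelType L = c.1) (h₂ : labelType L * c.2 = c.2)
    (hS : CutsIn L c.1 c.2 S) :
    ∃ Ls : List (List (FreeMonoid A × M)), Ls ≠ [] ∧ Ls.flatten = L ∧ ∀ K ∈ Ls, K ≠ [] ∧
      c.1 * labelType K = c.1 ∧ labelType K * c.2 = c.2 ∧ CutsIn K c.1 c.2 (S \ {c}) := by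
  induction hn : L.length using Nat.strong_induction_on generalizing L with
  | _ n ih =>
    by_cases h : CutsIn L c.1 c.2 {c}ᶜ
    · refine ⟨[L], by simp, by simp, ?_⟩
      intro K hK
      obtain rfl := List.mem_singleton.1 hK
      exact ⟨hL, h₁, h₂, fun P Q hP hQ e => ⟨hS P Q hP hQ e, h P Q hP hQ e⟩⟩
    · simp only [CutsIn, not_forall, Set.mem_compl_iff, Set.mem_singleton_iff, not_not] at h
      obtain ⟨P, Q, hP, hQ, rfl, hc⟩ := h
      have c₁ : c.1 * labelType P = c.1 := congrArg Prod.fst hc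
      have c₂ : labelType Q * c.2 = c.2 := congrArg Prod.snd hc
      have lP := List.length_pos_of_ne_nil hP
      have lQ := List.length_pos_of_ne_nil hQ
      simp only [List.length_append] at hn
      obtain ⟨Ps, p₁, p₂, p₃⟩ := ih P.length (by omega) P hP c₁
        (by rw [labelType_append, mul_assoc, c₂] at h₂; exact h₂) (by simpa [c₂] using hS.left) rfl
      obtain ⟨Qs, q₁, q₂, q₃⟩ := ih Q.length (by omega) Q hQ
        (by rw [labelType_append, ← mul_assoc, c₁] at h₁; exact h₁) c₂
        (by simpa [c₁] using hS.right) rfl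
      refine ⟨Ps ++ Qs, by simp [p₁], by simp [p₂, q₂], fun K hK => ?_⟩
      rcases List.mem_append.1 hK with h | h
      exacts [p₃ K h, q₃ K h]

variable {φ : FreeMonoid A →* M} {sharp : Idempotents M → Idempotents M} {k : ℕ}

/-- `HasDrop φ sharp k J n L`: some infix of `L` is the word of a tree whose root is an iteration
of an idempotent in `J` that is not stable under `sharp`. -/
def HasDrop (φ : FreeMonoid A →* M) (sharp : Idempotents M → Idempotents M) (k : ℕ) (J : Set M)
    (n : ℕ) (L : List (FreeMonoid A × M)) : Prop :=
  ∃ K, K <:+: L ∧ K ≠ [] ∧ ∃ E : Idempotents M, (E : M) ∈ J ∧ sharp E ≠ E ∧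
    HasTree φ sharp k n (labelWord K) (sharp E)

theorem HasDrop.mono {J : Set M} {m n : ℕ} (hmn : m ≤ n) {K L : List (FreeMonoid A × M)}
    (hKL : K <:+: L) (h : HasDrop φ sharp k J m K) : HasDrop φ sharp k J n L := by
  obtain ⟨K', h₁, h₂, E, h₃, h₄, h₅⟩ := h
  exact ⟨K', h₁.trans hKL, h₂, E, h₃, h₄, h₅.mono hmn⟩

/-- All pieces and their total product fix `a` and `b`, hence coincide with one idempotent `E`; one
node joins them. An iteration node does no harm if `sharp E = E` and is a drop otherwise. -/
theorem IsStable.hasTree_or_hasDrop_mid {J : Set M} (hJ : IsStable J) {n : ℕ} {a b : M}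
    (ha : a ∈ J) (hb : b ∈ J) {Ls : List (List (FreeMonoid A × M))} (hne : Ls ≠ [])
    (hflat : labelType Ls.flatten ∈ J)
    (h₁ : a * labelType Ls.flatten = a) (h₂ : labelType Ls.flatten * b = b)
    (h : ∀ K ∈ Ls, K ≠ [] ∧ labelType K ∈ J ∧ a * labelType K = a ∧ labelType K * b = b ∧
      HasTree φ sharp k n (labelWord K) (labelType K)) :
    HasTree φ sharp k (n + 1) (labelWord Ls.flatten) (labelType Ls.flatten) ∨
      HasDrop φ sharp k J (n + 1) Ls.flatten := by
  let E : Idempotents M := ⟨_, hJ.isIdempotentElem ha hflat h₁⟩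
  have hE : ∀ K ∈ Ls, labelType K = E := fun K hK =>
    hJ.eq_of_fix ha hb (h K hK).2.1 hflat (h K hK).2.2.1 h₁ (h K hK).2.2.2.1 h₂
  have key := HasTree.prod (φ := φ) (sharp := sharp) (k := k) (n := n) (E := E)
    (us := Ls.map labelWord) (by simpa using hne) (by
      intro u hu
      obtain ⟨K, hK, rfl⟩ := List.mem_map.1 hu
      exact hE K hK ▸ (h K hK).2.2.2.2)
  rw [← labelWord_flatten] at key
  rcases key with key | key
  · exact .inl key
  · by_cases hs : sharp E = E
    · rw [hs] at key
      exact .inl key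
    · refine .inr ⟨_, List.infix_refl _, ?_, E, hflat, hs, key⟩
      obtain ⟨K, hK⟩ := List.exists_mem_of_ne_nil _ hne
      simp only [ne_eq, List.flatten_eq_nil_iff, not_forall]
      exact ⟨K, hK, (h K hK).1⟩

/-- A sequence of trees all of whose infixes have their product in a stable set `J` is the word of
a tree with the same product, unless some infix drops out of `J` by an iteration. -/
theorem IsStable.hasTree_or_hasDrop {J : Set M} (hJ : IsStable J) {h : ℕ} (S : Finset (M × M))
    (hS : ∀ c ∈ S, c.1 ∈ J ∧ c.2 ∈ J) (L : List (FreeMonoid A × M)) (x y : M) (hL : L ≠ [])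
    (htree : ∀ p ∈ L, HasTree φ sharp k h p.1 p.2)
    (hinf : ∀ K, K <:+: L → K ≠ [] → labelType K ∈ J) (hcut : CutsIn L x y S) :
    HasTree φ sharp k (h + 3 * S.card) (labelWord L) (labelType L) ∨
      HasDrop φ sharp k J (h + 3 * S.card) L := by
  classical
  induction hn : S.card generalizing S L x y with
  | zero =>
    obtain rfl := Finset.card_eq_zero.1 hn
    -- With no pair allowed there is no inner position.
    match L, hL with
    | [p], _ => exact .inl (by simpa using htree p)
    | p :: q :: L, _ => simpa using hcut [p] (q :: L) (by simp) (by simp) rfl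
  | succ n ih =>
    obtain ⟨c, hc⟩ : S.Nonempty := Finset.card_pos.1 (by omega)
    obtain ⟨ha, hb⟩ := hS c hc
    have ih' : ∀ K, K <:+: L → K ≠ [] → ∀ x y, CutsIn K x y (S \ {c}) →
        HasTree φ sharp k (h + 3 * n) (labelWord K) (labelType K) ∨
          HasDrop φ sharp k J (h + 3 * n) K := by
      intro K hK hne x y hcut
      refine ih (S.erase c) (fun d hd => hS d (Finset.mem_of_mem_erase hd)) K x y hne
        (fun p hp => htree p (hK.subset hp)) (fun K' hK' => hinf K' (hK'.trans hK)) ?_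
        (by rw [Finset.card_erase_of_mem hc, hn]; rfl)
      simpa using hcut
    have diff : ∀ {K : List (FreeMonoid A × M)} {x y}, CutsIn K x y S → CutsIn K x y {c}ᶜ →
        CutsIn K x y (S \ {c}) := fun h₁ h₂ P Q hP hQ e => ⟨h₁ P Q hP hQ e, h₂ P Q hP hQ e⟩
    have drop : ∀ {m K}, m ≤ h + 3 * (n + 1) → K <:+: L → HasDrop φ sharp k J m K →
        HasDrop φ sharp k J (h + 3 * (n + 1)) L := fun hm hK hd => hd.mono hm hK
    rcases exists_first_cut c L x y with hno | ⟨P, R, hP, hR, rfl, hxP, hRy, hPc⟩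
    · rcases ih' L (List.infix_refl _) hL x y (diff hcut hno) with t | d
      · exact .inl (t.mono (by omega))
      · exact .inr (drop (by omega) (List.infix_refl _) d)
    have iP : P <:+: P ++ R := List.infix_append_left
    rcases ih' P iP hP x c.2 (diff (hRy ▸ hcut.left) hPc) with tP | d
    swap
    · exact .inr (drop (by omega) iP d)
    have hcutR : CutsIn R c.1 y S := hxP ▸ hcut.right
    rw [labelWord_append, labelType_append]
    rcases exists_last_cut c R c.1 y with hno | ⟨K, Q, hK, hQ, rfl, hKa, hQy, hQc⟩
    · rcases ih' R List.infix_append_right hR _ _ (diff hcutR hno) with t | d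
      · exact .inl ((tP.mul t).mono (by omega))
      · exact .inr (drop (by omega) List.infix_append_right d)
    have iQ : Q <:+: P ++ (K ++ Q) := ⟨P ++ K, [], by simp⟩
    have iK : K <:+: P ++ (K ++ Q) := ⟨P, Q, by simp⟩
    rcases ih' Q iQ hQ _ _ (diff (hKa ▸ hcutR.right) hQc) with tQ | d
    swap
    · exact .inr (drop (by omega) iQ d)
    have hKb : labelType K * c.2 = c.2 := by
      rw [labelType_append, mul_assoc, hQy] at hRy
      exact hRy
    obtain ⟨Ls, l₁, rfl, l₃⟩ := exists_flatten_cuts c S K hK hKa hKb (hQy ▸ hcutR.left)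
    have sub : ∀ K ∈ Ls, K <:+: P ++ (Ls.flatten ++ Q) := fun K hK => by
      obtain ⟨s, t, rfl⟩ := List.append_of_mem hK
      exact List.IsInfix.trans ⟨s.flatten, t.flatten, by simp⟩ iK
    by_cases hd : ∃ K ∈ Ls, HasDrop φ sharp k J (h + 3 * n) K
    · obtain ⟨K, hK, hd⟩ := hd
      exact .inr (drop (by omega) (sub K hK) hd)
    push Not at hd
    have key := hJ.hasTree_or_hasDrop_mid (φ := φ) (sharp := sharp) (k := k) (n := h + 3 * n)
      ha hb l₁ (hinf _ iK hK) hKa hKb fun K hK =>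
      ⟨(l₃ K hK).1, hinf _ (sub K hK) (l₃ K hK).1, (l₃ K hK).2.1, (l₃ K hK).2.2.1,
        (ih' K (sub K hK) (l₃ K hK).1 _ _ (l₃ K hK).2.2.2).resolve_right (hd K hK)⟩
    rcases key with t | d
    · refine .inl ?_
      rw [labelWord_append, labelType_append]
      -- The three levels for `c`: the joining node and two products.
      exact (tP.mono (n := h + 3 * n + 2) (by omega)).mul (t.mul (tQ.mono (Nat.le_succ _)))
    · exact .inr (drop (by omega) iK d)

end Smooth

/-! ### Descent through the ideals -/

section Levels

theorem Finset.card_eq_add_of_mem_iff {α : Type*} {I J K : Finset α}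
    (hIJK : ∀ m, m ∈ I ↔ m ∈ J ∨ m ∈ K)
    (hd : Disjoint J K) : I.card = J.card + K.card := by
  classical
  rw [← Finset.card_union_of_disjoint hd]
  congr 1
  ext m
  simp [hIJK]

variable {A M : Type*} [Monoid M] {φ : FreeMonoid A →* M}
  {sharp : Idempotents M → Idempotents M} {k : ℕ}

theorem labelType_mem_of_isMulIdeal {I : Finset M} (hI : IsMulIdeal I)
    {L : List (FreeMonoid A × M)} (hL : L ≠ []) (h : ∀ p ∈ L, p.2 ∈ I) : labelType L ∈ I := by
  obtain ⟨p, R, rfl⟩ := List.exists_cons_of_ne_nil hL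
  have := hI 1 (labelType R) p.2 (h p (by simp))
  simpa [labelType] using this

/-- One level of the construction: trees with types in `J ∪ K`, where `K` is an ideal and `J` a
maximal `J`-class, are joined to a single tree or to a sequence of trees with types in `K`. -/
theorem exists_trees_of_level
    (mul_sharp : ∀ e : Idempotents M, (e : M) * (sharp e : M) = (sharp e : M))
    (sharp_mul : ∀ e : Idempotents M, (sharp e : M) * (e : M) = (sharp e : M))
    {I J K : Finset M} (hI : IsMulIdeal I) (hJ : IsStable (J : Set M)) (hK : IsMulIdeal K)
    (hIJK : ∀ m, m ∈ I ↔ m ∈ J ∨ m ∈ K) {h : ℕ} {L : List (FreeMonoid A × M)} (hL : L ≠ [])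
    (hLI : ∀ p ∈ L, p.2 ∈ I ∧ HasTree φ sharp k h p.1 p.2) :
    HasTree φ sharp k (h + 3 * J.card ^ 2) (labelWord L) (labelType L) ∨
      ∃ D : List (FreeMonoid A × M), D ≠ [] ∧ labelWord D = labelWord L ∧
        ∀ p ∈ D, p.2 ∈ K ∧ HasTree φ sharp k (h + 3 * J.card ^ 2 + 2) p.1 p.2 := by
  classical
  set H := h + 3 * J.card ^ 2 with hH
  -- Cleanness excludes drops, so a clean sequence becomes a tree with its own product as type.
  let Clean : List (FreeMonoid A × M) → Prop := fun r =>
    ∀ q, q <:+: r → q ≠ [] → labelType q ∈ J ∧ ¬ ∃ V ∈ K, HasTree φ sharp k H (labelWord q) V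
  have clean_mono : ∀ {q r}, q <:+: r → Clean r → Clean q := fun hqr hr q' hq' =>
    hr q' (hq'.trans hqr)
  have clean_tree : ∀ r, r ≠ [] → Clean r → (∀ p ∈ r, HasTree φ sharp k h p.1 p.2) →
      HasTree φ sharp k H (labelWord r) (labelType r) := by
    intro r hr hc ht
    have key := hJ.hasTree_or_hasDrop (φ := φ) (sharp := sharp) (k := k) (h := h) (J ×ˢ J)
      (fun c hc => Finset.mem_product.1 hc) r 1 1 hr ht (fun q hq hne => (hc q hq hne).1) (by
        rintro P Q hP hQ rfl
        simpa using And.intro (hc P List.infix_append_left hP).1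
          (hc Q List.infix_append_right hQ).1)
    rw [Finset.card_product, ← sq, ← hH] at key
    refine key.resolve_right ?_
    rintro ⟨q, hq, hne, E, hE, hsE, ht⟩
    refine (hc q hq hne).2 ⟨_, ?_, ht⟩
    have hmem : (sharp E : M) ∈ I := by
      simpa [mul_sharp] using hI 1 (sharp E : M) E ((hIJK _).2 (.inl hE))
    exact ((hIJK _).1 hmem).resolve_left (hJ.sharp_notMem mul_sharp sharp_mul hE hsE)
  have greedy : ∀ L : List (FreeMonoid A × M),
      (∀ p ∈ L, p.2 ∈ I ∧ HasTree φ sharp k h p.1 p.2) →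
      ∃ D r : List (FreeMonoid A × M), labelWord D * labelWord r = labelWord L ∧ r <:+ L ∧
        (D = [] → r = L) ∧ Clean r ∧ ∀ p ∈ D, p.2 ∈ K ∧ HasTree φ sharp k (H + 1) p.1 p.2 := by
    intro L
    induction L using List.reverseRecOn with
    | nil =>
      intro _
      refine ⟨[], [], rfl, List.suffix_refl _, fun _ => rfl, fun q hq hne => ?_, by simp⟩
      exact absurd (List.infix_nil.1 hq) hne
    | append_singleton L a ih =>
      intro hLI
      obtain ⟨D, r, hw, hs, hD, hr, hDK⟩ := ih fun p hp => hLI p (by simp [hp])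
      have hra : r ++ [a] <:+ L ++ [a] := by
        obtain ⟨t, rfl⟩ := hs
        exact ⟨t, by simp⟩
      have hraI : ∀ p ∈ r ++ [a], p.2 ∈ I ∧ HasTree φ sharp k h p.1 p.2 := fun p hp =>
        hLI p (hra.subset hp)
      by_cases hc : Clean (r ++ [a])
      · exact ⟨D, r ++ [a], by simp [← hw, mul_assoc], hra, fun h => by rw [hD h], hc, hDK⟩
      -- the whole of `r ++ [a]` becomes one tree with type in `K`
      suffices hsuff : ∃ V ∈ K, HasTree φ sharp k (H + 1) (labelWord (r ++ [a])) V by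
        obtain ⟨V, hV, ht⟩ := hsuff
        refine ⟨D ++ [(labelWord (r ++ [a]), V)], [], by simp [← hw, mul_assoc],
          List.nil_suffix, by simp, fun q hq hne => absurd (List.infix_nil.1 hq) hne, ?_⟩
        intro p hp
        rcases List.mem_append.1 hp with hp | hp
        · exact hDK p hp
        · obtain rfl := List.mem_singleton.1 hp
          exact ⟨hV, ht⟩
      have hhH : h ≤ H := Nat.le_add_right _ _
      have r_tree : r ≠ [] → HasTree φ sharp k H (labelWord r) (labelType r) := fun hne =>
        clean_tree r hne hr fun p hp => (hraI p (by simp [hp])).2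
      have ha := hraI a (by simp)
      obtain ⟨q, hq, hne, hbad⟩ : ∃ q, q <:+: r ++ [a] ∧ q ≠ [] ∧
          (labelType q ∈ J → ∃ V ∈ K, HasTree φ sharp k H (labelWord q) V) := by
        simpa only [Clean, not_forall, not_and, not_not, exists_prop] using hc
      -- Since `r` is clean, the offending infix must be a suffix of `r ++ [a]`.
      rcases List.infix_concat_iff.1 hq with hq' | hq'
      swap
      · exact absurd (hbad (hr q hq' hne).1) (hr q hq' hne).2
      obtain ⟨s, hsq⟩ := hq'
      by_cases hqJ : labelType q ∈ J
      · obtain ⟨V, hV, ht⟩ := hbad hqJ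
        rw [← hsq, labelWord_append]
        rcases eq_or_ne s [] with rfl | hs'
        · exact ⟨V, hV, by simpa using ht.mono (Nat.le_succ _)⟩
        · have hsr : s <:+: r := by
            obtain ⟨q', b, rfl⟩ := List.eq_nil_or_concat' q |>.resolve_left hne
            rw [← List.append_assoc] at hsq
            exact ⟨[], q', by simpa using (List.append_inj' hsq rfl).1⟩
          refine ⟨labelType s * V, by simpa using hK (labelType s) 1 V hV, HasTree.mul ?_ ht⟩
          exact clean_tree s hs' (clean_mono hsr hr) fun p hp =>
            (hraI p (by simp [hsr.subset hp])).2
      · have hqK : labelType q ∈ K :=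
          ((hIJK _).1 (labelType_mem_of_isMulIdeal hI hne fun p hp =>
            (hraI p (hq.subset hp)).1)).resolve_left hqJ
        refine ⟨labelType (r ++ [a]), ?_, ?_⟩
        · rw [← hsq, labelType_append]
          simpa using hK (labelType s) 1 _ hqK
        · rw [labelWord_append, labelType_append, labelWord_singleton, labelType_singleton]
          rcases eq_or_ne r [] with rfl | hr'
          · simpa using ha.2.mono (hhH.trans (Nat.le_succ _))
          · exact (r_tree hr').mul (ha.2.mono hhH)
  obtain ⟨D, r, hw, hs, hD, hr, hDK⟩ := greedy L hLI
  have r_tree : r ≠ [] → HasTree φ sharp k H (labelWord r) (labelType r) := fun hne =>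
    clean_tree r hne hr fun p hp => (hLI p (hs.subset hp)).2
  rcases List.eq_nil_or_concat' D with rfl | ⟨D, d, rfl⟩
  · obtain rfl := hD rfl
    exact .inl (r_tree hL)
  · right
    rcases eq_or_ne r [] with rfl | hr'
    · exact ⟨D ++ [d], by simp, by simpa using hw, fun p hp =>
        ⟨(hDK p hp).1, (hDK p hp).2.mono (Nat.le_succ _)⟩⟩
    -- The last label absorbs the clean remainder, staying in the ideal `K` at the cost of the
    -- second extra level.
    · refine ⟨D ++ [(d.1 * labelWord r, d.2 * labelType r)], by simp,
        by simpa [mul_assoc] using hw, fun p hp => ?_⟩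
      rcases List.mem_append.1 hp with hp | hp
      · exact ⟨(hDK p (by simp [hp])).1, (hDK p (by simp [hp])).2.mono (Nat.le_succ _)⟩
      · obtain rfl := List.mem_singleton.1 hp
        have hd := hDK d (by simp)
        exact ⟨by simpa using hK 1 (labelType r) _ hd.1,
          hd.2.mul ((r_tree hr').mono (Nat.le_succ _))⟩

theorem exists_hasTree_of_isMulIdeal [Finite M]
    (mul_sharp : ∀ e : Idempotents M, (e : M) * (sharp e : M) = (sharp e : M))
    (sharp_mul : ∀ e : Idempotents M, (sharp e : M) * (e : M) = (sharp e : M))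
    {I : Finset M} (hI : IsMulIdeal I) {h : ℕ} {L : List (FreeMonoid A × M)} (hL : L ≠ [])
    (hLI : ∀ p ∈ L, p.2 ∈ I ∧ HasTree φ sharp k h p.1 p.2) :
    ∃ V, HasTree φ sharp k (h + 3 * I.card ^ 2) (labelWord L) V := by
  induction hn : I.card using Nat.strong_induction_on generalizing I h L with
  | _ n ih =>
    subst hn
    obtain ⟨p, hp⟩ := List.exists_mem_of_ne_nil L hL
    obtain ⟨J, K, hne, hJ, hK, hIJK, hdis⟩ := hI.exists_stable ⟨p.2, (hLI p hp).1⟩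
    have hcard := Finset.card_eq_add_of_mem_iff hIJK hdis
    have hJ0 := hne.card_pos
    rcases exists_trees_of_level mul_sharp sharp_mul hI hJ hK hIJK hL hLI with t | ⟨D, d₁, d₂, d₃⟩
    · exact ⟨_, t.mono (by have := Nat.pow_le_pow_left (show J.card ≤ I.card by omega) 2; omega)⟩
    · obtain ⟨V, hV⟩ := ih K.card (by omega) hK d₁ d₃ rfl
      obtain ⟨q, hq⟩ := List.exists_mem_of_ne_nil D d₁
      have hK0 : 0 < K.card := Finset.card_pos.2 ⟨_, (d₃ q hq).1⟩
      refine ⟨V, d₂ ▸ hV.mono ?_⟩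
      rw [hcard]
      -- The cross term `6 * J.card * K.card` covers the 2 extra levels.
      nlinarith [Nat.mul_pos hJ0 hK0]

/-- If the whole monoid is stable, the products of the two parts of a cut are tied together. -/
theorem exists_hasTree_of_isStable_univ [Finite M]
    (mul_sharp : ∀ e : Idempotents M, (e : M) * (sharp e : M) = (sharp e : M))
    (sharp_mul : ∀ e : Idempotents M, (sharp e : M) * (e : M) = (sharp e : M))
    (hJ : IsStable (Set.univ : Set M)) {L : List (FreeMonoid A × M)} (hL : L ≠ [])
    (hLI : ∀ p ∈ L, HasTree φ sharp k 1 p.1 p.2) :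
    ∃ V, HasTree φ sharp k (3 * Nat.card M ^ 2) (labelWord L) V := by
  classical
  have := Fintype.ofFinite M
  rw [Nat.card_eq_fintype_card]
  rcases subsingleton_or_nontrivial M with hM | hM
  · have hc : Fintype.card M = 1 := Fintype.card_eq_one_iff.2 ⟨1, fun _ => Subsingleton.elim _ _⟩
    have key := HasTree.prod (φ := φ) (sharp := sharp) (k := k) (n := 1)
      (E := ⟨1, IsIdempotentElem.one⟩) (us := L.map Prod.fst) (by simpa using hL) (by
        intro u hu
        obtain ⟨p, hp, rfl⟩ := List.mem_map.1 hu
        simpa only [Subsingleton.elim p.2 1] using hLI p hp)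
    rw [hc]
    rcases key with t | t
    exacts [⟨_, t.mono (by norm_num)⟩, ⟨_, t.mono (by norm_num)⟩]
  -- Every cut pair multiplies to the total product. This omits at least one pair, which leaves room
  -- for the leaf level.
  · let S : Finset (M × M) := Finset.univ.filter fun c => c.1 * c.2 = labelType L
    have key := hJ.hasTree_or_hasDrop (φ := φ) (sharp := sharp) (k := k) (h := 1) S
      (fun _ _ => ⟨trivial, trivial⟩) L 1 1 hL hLI (fun _ _ _ => trivial) (by
        rintro P Q - - rfl
        simp [S])
    have hS : S.card < Fintype.card M ^ 2 := by
      obtain ⟨z, hz⟩ := exists_ne (labelType L)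
      rw [sq, ← Fintype.card_prod]
      exact Finset.card_lt_univ_of_notMem (x := (1, z)) (by simpa [S] using hz)
    rcases key with t | ⟨_, _, _, E, hE, hsE, _⟩
    · exact ⟨_, t.mono (by omega)⟩
    · exact absurd trivial (hJ.sharp_notMem mul_sharp sharp_mul hE hsE)

end Levels

/-! ### Assembly, starting from the leaves -/

theorem mainTheorem5 {A : Type*} [Finite A] {M : Type*} [Monoid M] [Finite M]
    (sharp : Idempotents M → Idempotents M)
    (sharp_sharp : ∀ e : Idempotents M, sharp (sharp e) = sharp e)
    (mul_sharp : ∀ e : Idempotents M, (e : M) * (sharp e : M) = (sharp e : M))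
    (sharp_mul : ∀ e : Idempotents M, (sharp e : M) * (e : M) = (sharp e : M))
    (φ : FreeMonoid A →* M) (w : FreeMonoid A) (hw : w ≠ 1) (k : ℕ) (hk : 3 < k) :
    ∃ T : WordTree A M,
      T.IsDecomposition φ sharp k ∧ T.word = w ∧ T.height ≤ 3 * Nat.card M ^ 2 := by
  classical
  have := Fintype.ofFinite M
  suffices h : ∃ V, HasTree φ sharp k (3 * Nat.card M ^ 2) w V by
    obtain ⟨V, T, h₁, h₂, -, h₄⟩ := h
    exact ⟨T, h₁, h₂, h₄⟩
  let L : List (FreeMonoid A × M) :=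
    (FreeMonoid.toList w).map fun a => (FreeMonoid.of a, φ (FreeMonoid.of a))
  have hLw : labelWord L = w := by
    induction w using FreeMonoid.inductionOn' with
    | one => rfl
    | of_mul a w ih =>
      rcases eq_or_ne w 1 with rfl | hne
      · simp [L, labelWord]
      · simpa [L, labelWord] using ih hne
  have hL : L ≠ [] := by
    intro h
    rw [h] at hLw
    exact hw hLw.symm
  have hLt : ∀ p ∈ L, HasTree φ sharp k 1 p.1 p.2 := by
    intro p hp
    obtain ⟨a, -, rfl⟩ := List.mem_map.1 hp
    exact HasTree.leaf a
  rw [← hLw]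
  have hI : IsMulIdeal (Finset.univ : Finset M) := fun _ _ _ _ => Finset.mem_univ _
  obtain ⟨J, K, hne, hJ, hK, hIJK, hdis⟩ := hI.exists_stable ⟨1, Finset.mem_univ _⟩
  have hcard := Finset.card_eq_add_of_mem_iff hIJK hdis
  rw [Finset.card_univ] at hcard
  have hJ0 := hne.card_pos
  rcases K.eq_empty_or_nonempty with rfl | hKne
  · have hJu : J = Finset.univ := by
      ext m
      simpa using (hIJK m)
    refine exists_hasTree_of_isStable_univ mul_sharp sharp_mul ?_ hL hLt
    rwa [hJu, Finset.coe_univ] at hJ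
  · have hK0 := hKne.card_pos
    rw [Nat.card_eq_fintype_card, hcard]
    have hJK := Nat.mul_pos hJ0 hK0
    rcases exists_trees_of_level mul_sharp sharp_mul hI hJ hK hIJK hL
      (fun p hp => ⟨Finset.mem_univ _, hLt p hp⟩) with t | ⟨D, d₁, d₂, d₃⟩
    · exact ⟨_, t.mono (by nlinarith)⟩
    · obtain ⟨V, hV⟩ := exists_hasTree_of_isMulIdeal mul_sharp sharp_mul hK d₁ d₃
      -- The cross term, at least 6, covers the leaf level and the 2 extra levels.
      exact ⟨V, d₂ ▸ hV.mono (by nlinarith)⟩
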